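/- **Setting.** For a metric space $X$, let $\mathcal P_X$ be the set of Radon probability measures on $X$ with the weak topology, and let $\mathcal P^{\mathrm{fin}}_X\subseteq\mathcal P_X$ be the subspace of finitely supported ones. For $\alpha,\beta\in\mathcal P_X$ let $$d^X_{\mathrm W,\infty}(\alpha,\beta)=\inf_{\mu}\ \sup_{(x,x')\in\operatorname{supp}(\mu)}d_X(x,x'),$$ where $\mu$ ranges over all couplings of $\alpha$ and $\beta$. The distortion of a map $f\colon X\to Y$ is $\operatorname{dis}(f)=\sup_{x,x'}|d_X(x,x')-d_Y(f(x),f(x'))|$. Let $\mathfrak i$ be a functional that associates to each bounded metric space $X$ a function $\mathfrak i^X\colon\mathcal P_X\to\mathbb R$. For $L>0$, $\mathfrak i$ is an *$L$-controlled invariant* if 1. $\mathfrak i^Y(f_\sharp\alpha)\le\mathfrak i^X(\alpha)+L\cdot\operatorname{dis}(f)$ for every map $f\colon X\to Y$ between finite metric spaces and every $\alpha\in\mathcal P_X$; 2. $|\mathfrak i^X(\alpha)-\mathfrak i^X(\beta)|\le 2L\cdot d^X_{\mathrm W,\infty}(\alpha,\beta)$ for every bounded metric space $X$ and all $\alpha,\beta\in\mathcal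 P_X$. For a topological space $A$ and a (not necessarily continuous) function $\varphi\colon A\to\mathbb R$, let $[A;\varphi]_\bullet$ be the sublevel set filtration $r\mapsto\varphi^{-1}((-\infty,r))$, $r\in\mathbb R$, with the inclusions as structure maps. Let $H_k$ be singular homology in degree $k$ with coefficients in a fixed field. A *$\delta$-map* $(A,\varphi_A)\to(B,\varphi_B)$ is a continuous map $\Phi\colon A\to B$ with $\varphi_B(\Phi(a))\le\varphi_A(a)+\delta$ for all $a\in A$. Two pairs are *$\delta$-homotopy equivalent* ($\delta\ge 0$) if there are $\delta$-maps $\Phi\colon A\to B$ and $\Psi\colon B\to A$ such that $\Psi\circ\Phi$ is homotopic to $\mathrm{id}_A$, and $\Phi\circ\Psi$ is homotopic to $\mathrm{id}_B$, each through $2\delta$-maps. The *homotopy type distance* $d_{\mathrm{HT}}((A,\varphi_A),(B,\varphi_B))\in[0,\infty]$ is the infimum of all such $\delta$. Two functors $V,W$ from the poset $(\mathbb R,\le)$ to vector spaces are *$\delta$-interleaved* ($\delta\ge0$) if there are natural transformations $V(t)\to W(t+\delta)$ and $W(t)\to V(t+\delta)$ whose composites $V(t)\to V(t+2\delta)$ and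 $W(t)\to W(t+2\delta)$ are the structure maps. The *interleaving distance* $d_{\mathrm I}(V,W)\in[0,\infty]$ is the infimum of all such $\delta$. **Corollary.** Let $X$ be a totally bounded metric space, let $k\ge 0$ be an integer, let $L>0$, and let $\mathfrak i$ be an $L$-controlled invariant. Then $$d_{\mathrm I}\big(H_k\circ[\mathcal P_X;\mathfrak i^X]_\bullet,\ H_k\circ[\mathcal P^{\mathrm{fin}}_X;\mathfrak i^X]_\bullet\big)=d_{\mathrm{HT}}\big((\mathcal P_X,\mathfrak i^X),(\mathcal P^{\mathrm{fin}}_X,\mathfrak i^X)\big)=0,$$ where $\mathfrak i^X$ on $\mathcal P^{\mathrm{fin}}_X$ denotes the restriction. -/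

import Mathlib

open CategoryTheory MeasureTheory
open scoped NNReal ENNReal

universe u v

noncomputable section

/-! ### Radon probability measures -/

/-- The space of Radon probability measures on `X`: Borel probability measures for which the measure
of every Borel set is the supremum of the measures of its compact subsets. As a subtype of
`ProbabilityMeasure X` it carries the weak topology. -/
abbrev RadonProb (X : Type u) [TopologicalSpace X] [MeasurableSpace X] [BorelSpace X] : Type u :=
  {α : ProbabilityMeasure X // (α : Measure X).InnerRegular}

/-- The Radon probability measures with finite support, with the subspace topology (that is, again
the weak topology). -/
abbrev FinRadonProb (X : Type u) [TopologicalSpace X] [MeasurableSpace X] [BorelSpace X] : Type u :=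
  {α : RadonProb X // (α.1 : Measure X).support.Finite}

/-- Pushforward of a Radon probability measure along a continuous map. -/
def RadonProb.map {X Y : Type u} [TopologicalSpace X] [MeasurableSpace X] [BorelSpace X]
    [TopologicalSpace Y] [MeasurableSpace Y] [BorelSpace Y]
    (f : X → Y) (hf : Continuous f) (α : RadonProb X) : RadonProb Y :=
  ⟨α.1.map hf.measurable.aemeasurable, by
    have := α.2
    exact Measure.InnerRegular.map_of_continuous hf⟩

/-- The couplings of two Radon probability measures: the measures on the product with the prescribed
marginals (such a measure automatically has total mass one). -/
def couplings {X : Type u} [TopologicalSpace X] [MeasurableSpace X] [BorelSpace X]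
    (α β : RadonProb X) : Set (Measure (X × X)) :=
  {μ | μ.map Prod.fst = (α.1 : Measure X) ∧ μ.map Prod.snd = (β.1 : Measure X)}

/-- The `∞`-Wasserstein distance: the infimum over all couplings `μ` of the supremum of the distance
over the support of `μ`. It is finite if `X` is bounded. -/
def wassersteinInfty {X : Type u} [MetricSpace X] [MeasurableSpace X] [BorelSpace X]
    (α β : RadonProb X) : ℝ≥0∞ :=
  ⨅ μ ∈ couplings α β, ⨆ z ∈ μ.support, edist z.1 z.2

/-! ### Controlled invariants -/

/-- The distortion of a map, as a real supremum; it is used for maps between finite metric spaces,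
where the supremum is over a finite set. -/
def distortion {X Y : Type u} [MetricSpace X] [MetricSpace Y] (f : X → Y) : ℝ :=
  ⨆ p : X × X, |dist p.1 p.2 - dist (f p.1) (f p.2)|

/-- A functional that associates to each bounded metric space `X` (with its Borel `σ`-algebra) a
real-valued function on the Radon probability measures on `X`. -/
abbrev MeasureFunctional : Type (u + 1) :=
  ∀ (X : Type u) [MetricSpace X] [BoundedSpace X] [MeasurableSpace X] [BorelSpace X],
    RadonProb X → ℝ

/-- `L`-controlled invariants, for `L > 0`. Any map between finite metric spaces is continuous, since
these are discrete. -/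
structure IsControlledInvariant (L : ℝ) (i : MeasureFunctional.{u}) : Prop where
  pos : 0 < L
  pushforward_le : ∀ (X Y : Type u) [MetricSpace X] [Finite X] [MeasurableSpace X] [BorelSpace X]
    [MetricSpace Y] [Finite Y] [MeasurableSpace Y] [BorelSpace Y] (f : X → Y) (α : RadonProb X),
    i Y (α.map f continuous_of_discreteTopology) ≤ i X α + L * distortion f
  abs_sub_le : ∀ (X : Type u) [MetricSpace X] [BoundedSpace X] [MeasurableSpace X] [BorelSpace X]
    (α β : RadonProb X),
    ENNReal.ofReal |i X α - i X β| ≤ ENNReal.ofReal (2 * L) * wassersteinInfty α β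

/-! ### The homotopy type distance -/

/-- The condition that a continuous map is a `δ`-map between two spaces with real-valued functions,
which need not be continuous. -/
def IsDeltaMap {A B : Type u} [TopologicalSpace A] [TopologicalSpace B] (φA : A → ℝ) (φB : B → ℝ)
    (δ : ℝ) (Φ : C(A, B)) : Prop :=
  ∀ a, φB (Φ a) ≤ φA a + δ

/-- `δ`-homotopy equivalence of pairs. `HomotopicWith` asks for a homotopy all of whose stages satisfy
the given predicate, here that of being a `2δ`-map. -/
def DeltaHomotopyEquiv {A B : Type u} [TopologicalSpace A] [TopologicalSpace B]
    (φA : A → ℝ) (φB : B → ℝ) (δ : ℝ) : Prop :=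
  ∃ (Φ : C(A, B)) (Ψ : C(B, A)), IsDeltaMap φA φB δ Φ ∧ IsDeltaMap φB φA δ Ψ ∧
    (Ψ.comp Φ).HomotopicWith (ContinuousMap.id A) (IsDeltaMap φA φA (2 * δ)) ∧
    (Φ.comp Ψ).HomotopicWith (ContinuousMap.id B) (IsDeltaMap φB φB (2 * δ))

/-- The homotopy type distance between two pairs; it is `∞` if they are not `δ`-homotopy equivalent
for any `δ ≥ 0`. -/
def homotopyTypeDist {A B : Type u} [TopologicalSpace A] [TopologicalSpace B]
    (φA : A → ℝ) (φB : B → ℝ) : ℝ≥0∞ :=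
  ⨅ (δ : ℝ≥0) (_ : DeltaHomotopyEquiv φA φB δ), (δ : ℝ≥0∞)

/-! ### Interleavings -/

/-- The translation `t ↦ t + δ` as an endofunctor of the poset `ℝ`. -/
def realShift (δ : ℝ) : ℝ ⥤ ℝ :=
  Monotone.functor (f := fun t => t + δ) fun _ _ h => add_le_add_left h δ

/-- `δ`-interleavings of two functors from the poset `ℝ`. The composites below are required to be the
structure maps from time `t` to time `t + δ + δ`. -/
def Interleaved {C : Type*} [Category C] (F G : ℝ ⥤ C) (δ : ℝ≥0) : Prop :=
  ∃ (φ : F ⟶ realShift δ ⋙ G) (ψ : G ⟶ realShift δ ⋙ F),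
    (∀ t : ℝ, φ.app t ≫ ψ.app (t + δ) =
      F.map (homOfLE (by linarith [δ.coe_nonneg] : t ≤ t + δ + δ))) ∧
    (∀ t : ℝ, ψ.app t ≫ φ.app (t + δ) =
      G.map (homOfLE (by linarith [δ.coe_nonneg] : t ≤ t + δ + δ)))

/-- The interleaving distance. -/
def interleavingDist {C : Type*} [Category C] (F G : ℝ ⥤ C) : ℝ≥0∞ :=
  ⨅ (δ : ℝ≥0) (_ : Interleaved F G δ), (δ : ℝ≥0∞)

/-! ### Sublevel set filtrations and persistent homology -/

/-- The filtration of `A` by the open sublevel sets `{a | φ a < r}` with their subspace topologies,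
with the inclusions as structure maps. -/
def sublevelFiltration {A : Type u} [TopologicalSpace A] (φ : A → ℝ) : ℝ ⥤ TopCat.{u} where
  obj r := TopCat.of {a : A // φ a < r}
  map {_ _} h := TopCat.ofHom
    { toFun := fun a => ⟨a.1, a.2.trans_le (leOfHom h)⟩
      continuous_toFun := by fun_prop }

/-- Singular homology in degree `k` with coefficients in the field `K`. (The lift only moves `K` to
the universe in which the homology of a space in universe `u` lives.) -/
def singularHomologyField (K : Type v) [Field K] (k : ℕ) :
    TopCat.{u} ⥤ ModuleCat.{max u v} K :=
  (AlgebraicTopology.singularHomologyFunctor.{u} (ModuleCat.{max u v} K) k).obj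
    (ModuleCat.of K (ULift.{u} K))

/-- The degree-`k` persistent homology of the sublevel set filtration of `φ`. -/
def persistentHomology (K : Type v) [Field K] (k : ℕ) {A : Type u} [TopologicalSpace A]
    (φ : A → ℝ) : ℝ ⥤ ModuleCat.{max u v} K :=
  sublevelFiltration φ ⋙ singularHomologyField K k

end

/-! ### Homotopy invariance and interleavings -/

section Interleaving

variable {A B : Type u} [TopologicalSpace A] [TopologicalSpace B]

/-! For `ε > 0`, total boundedness gives a finite `ε`-net with a subordinate partition of unity `ζ
p`. Replacing `α` by `∑ (∫ ζ p dα) δ_p` is weakly continuous, yields finite support, and moves no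
mass further than `ε`. The same holds for moving only the fraction `t` of the mass, except that
finite support is then merely preserved. So the whole segment from `α` to its discretization stays
within `wassersteinInfty` distance `ε` of `α` (`RadonProb.wassersteinInfty_discretizeLine_le`), and
`i` varies by at most `2 * L * ε` from its value at `α`. Discretization and inclusion are thus
inverse up to these segments (`IsControlledInvariant.deltaHomotopyEquiv`), and `ε → 0` gives
homotopy type distance zero. Homotopy invariance of homology bounds the interleaving distance by it.
-/

lemma singularHomologyField_map_eq_of_homotopic (K : Type v) [Field K] (k : ℕ) {S T : TopCat.{u}}
    {f g : S ⟶ T} (H : ContinuousMap.Homotopic f.hom g.hom) :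
    (singularHomologyField K k).map f = (singularHomologyField K k).map g :=
  TopCat.Homotopy.congr_homologyMap_singularChainComplexFunctor H.some _ k

/-- The map between sublevel sets induced by a `δ`-map. -/
def IsDeltaMap.sublevelMap {φA : A → ℝ} {φB : B → ℝ} {δ : ℝ} {Φ : C(A, B)}
    (hΦ : IsDeltaMap φA φB δ Φ) {r s : ℝ} (h : r + δ ≤ s) :
    (sublevelFiltration φA).obj r ⟶ (sublevelFiltration φB).obj s :=
  TopCat.ofHom
    { toFun := fun a => ⟨Φ a.1, by linarith [hΦ a.1, a.2]⟩
      continuous_toFun := by fun_prop }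

/-- A `δ`-map induces a morphism of filtrations that shifts by `δ`. -/
def IsDeltaMap.sublevelNatTrans {φA : A → ℝ} {φB : B → ℝ} {δ : ℝ} {Φ : C(A, B)}
    (hΦ : IsDeltaMap φA φB δ Φ) :
    sublevelFiltration φA ⟶ realShift δ ⋙ sublevelFiltration φB where
  app r := hΦ.sublevelMap (le_refl (r + δ))
  naturality _ _ _ := rfl

/-- Every stage of the homotopy raises `φA` by at most `2 * δ`, so the homotopy restricts to a map
from the sublevel set at `t` into the one at `t + δ + δ`. -/
lemma homotopic_sublevelFiltration_map {φA : A → ℝ} {φB : B → ℝ} {δ : ℝ} {Φ : C(A, B)}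
    {Ψ : C(B, A)} (hΦ : IsDeltaMap φA φB δ Φ) (hΨ : IsDeltaMap φB φA δ Ψ)
    (H : (Ψ.comp Φ).HomotopicWith (ContinuousMap.id A) (IsDeltaMap φA φA (2 * δ)))
    (t : ℝ) (ht : t ≤ t + δ + δ) :
    ContinuousMap.Homotopic
      (hΦ.sublevelNatTrans.app t ≫ hΨ.sublevelNatTrans.app (t + δ)).hom
      ((sublevelFiltration φA).map (homOfLE ht)).hom := by
  obtain ⟨F⟩ := H
  refine ⟨⟨⟨fun p => ⟨F (p.1, p.2.1), ?_⟩, ?_⟩, ?_, ?_⟩⟩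
  · have h1 : φA (F (p.1, p.2.1)) ≤ φA p.2.1 + 2 * δ := F.prop' p.1 p.2.1
    have h2 : φA p.2.1 < t := p.2.2
    change φA (F (p.1, p.2.1)) < t + δ + δ
    linarith
  · have h : Continuous fun p : unitInterval × {a : A // φA a < t} => F (p.1, p.2.1) := by
      fun_prop
    exact h.subtype_mk _
  · intro x
    exact Subtype.ext (F.apply_zero x.1)
  · intro x
    exact Subtype.ext (F.apply_one x.1)

theorem DeltaHomotopyEquiv.interleaved_persistentHomology (K : Type v) [Field K] (k : ℕ)
    {φA : A → ℝ} {φB : B → ℝ} {δ : ℝ≥0} (h : DeltaHomotopyEquiv φA φB δ) :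
    Interleaved (persistentHomology K k φA) (persistentHomology K k φB) δ := by
  obtain ⟨Φ, Ψ, hΦ, hΨ, hA, hB⟩ := h
  refine ⟨Functor.whiskerRight hΦ.sublevelNatTrans (singularHomologyField K k),
    Functor.whiskerRight hΨ.sublevelNatTrans (singularHomologyField K k), fun t => ?_, fun t => ?_⟩
  · exact ((singularHomologyField K k).map_comp _ _).symm.trans
      (singularHomologyField_map_eq_of_homotopic K k
        (homotopic_sublevelFiltration_map hΦ hΨ hA t _))
  · exact ((singularHomologyField K k).map_comp _ _).symm.trans
      (singularHomologyField_map_eq_of_homotopic K k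
        (homotopic_sublevelFiltration_map hΨ hΦ hB t _))

theorem interleavingDist_persistentHomology_le (K : Type v) [Field K] (k : ℕ)
    (φA : A → ℝ) (φB : B → ℝ) :
    interleavingDist (persistentHomology K k φA) (persistentHomology K k φB) ≤
      homotopyTypeDist φA φB :=
  le_iInf₂ fun δ h => iInf₂_le δ (h.interleaved_persistentHomology K k)

end Interleaving

/-! ### Discretizing measures along a partition of unity -/

section Discretize

open scoped BoundedContinuousFunction unitInterval

variable {X : Type u} [MetricSpace X]

/-- Tent functions `max (ε - dist x p) 0` at the points of an `ε`-net have a nowhere vanishing sum,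
by which they are divided. -/
theorem exists_finite_partitionOfUnity (hX : TotallyBounded (Set.univ : Set X)) {ε : ℝ}
    (hε : 0 < ε) :
    ∃ (s : Finset X) (ζ : X → (X →ᵇ ℝ≥0)), (∀ x, ∑ p ∈ s, ζ p x = 1) ∧
      ∀ p x, ζ p x ≠ 0 → dist x p ≤ ε := by
  obtain ⟨s, -, hs, hcov⟩ := Metric.finite_approx_of_totallyBounded hX ε hε
  lift s to Finset X using hs
  let g : X → X → ℝ≥0 := fun p x => Real.toNNReal (ε - dist x p)
  have hg : ∀ p, Continuous (g p) := fun p => by fun_prop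
  have hpos : ∀ x, ∑ p ∈ s, g p x ≠ 0 := by
    intro x
    obtain ⟨p, hp, hxp⟩ := Set.mem_iUnion₂.1 (hcov (Set.mem_univ x))
    have h1 : 0 < g p x := Real.toNNReal_pos.2 (sub_pos.2 hxp)
    exact (h1.trans_le (Finset.single_le_sum (f := fun p => g p x) (fun _ _ => zero_le) hp)).ne'
  have hb : ∀ p ∈ s, ∀ x, g p x / ∑ q ∈ s, g q x ≤ 1 := fun p hp x =>
    div_le_one_of_le₀ (Finset.single_le_sum (f := fun p => g p x) (fun _ _ => zero_le) hp) zero_le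
  classical
  let ζ : X → (X →ᵇ ℝ≥0) := fun p =>
    if hp : p ∈ s then
      BoundedContinuousFunction.mkOfBound
        ⟨fun x => g p x / ∑ q ∈ s, g q x,
          (hg p).div₀ (continuous_finsetSum _ fun q _ => hg q) hpos⟩ 1 (fun x y => by
            rw [NNReal.dist_eq, abs_sub_le_iff]
            have h1 : ((g p x / ∑ q ∈ s, g q x : ℝ≥0) : ℝ) ≤ 1 := by exact_mod_cast hb p hp x
            have h2 : ((g p y / ∑ q ∈ s, g q y : ℝ≥0) : ℝ) ≤ 1 := by exact_mod_cast hb p hp y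
            have h3 := (g p x / ∑ q ∈ s, g q x).coe_nonneg
            have h4 := (g p y / ∑ q ∈ s, g q y).coe_nonneg
            constructor <;> simp only [ContinuousMap.coe_mk] <;> linarith)
    -- The value zero off `s` makes the distance bound hold for every `p`, not only for `p ∈ s`.
    else 0
  have hζ : ∀ p ∈ s, ∀ x, ζ p x = g p x / ∑ q ∈ s, g q x := by
    intro p hp x
    simp [ζ, hp]
  refine ⟨s, ζ, fun x => ?_, fun p x hpx => ?_⟩
  · rw [Finset.sum_congr rfl fun p hp => hζ p hp x, ← Finset.sum_div, div_self (hpos x)]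
  · by_cases hp : p ∈ s
    · rw [hζ p hp] at hpx
      by_contra! hlt
      exact hpx (by simp [g, Real.toNNReal_of_nonpos (sub_nonpos.2 hlt.le)])
    · simp [ζ, hp] at hpx

lemma map_finsetSum_measure {ι S T : Type*} [MeasurableSpace S] [MeasurableSpace T] {f : S → T}
    (hf : Measurable f) (s : Finset ι) (μ : ι → Measure S) :
    (∑ i ∈ s, μ i).map f = ∑ i ∈ s, (μ i).map f := by
  ext U hU
  simp [Measure.map_apply hf hU, Measure.finsetSum_apply]

variable [MeasurableSpace X]

/-- The discretization of a measure along a family of weight functions `ζ p`, `p ∈ s`: the sum of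
the point masses at `p ∈ s`, weighted by the integrals of `ζ p`. -/
noncomputable def discretize (s : Finset X) (ζ : X → (X →ᵇ ℝ≥0)) (α : FiniteMeasure X) :
    FiniteMeasure X :=
  ∑ p ∈ s, α.testAgainstNN (ζ p) • (diracProba p).toFiniteMeasure

/-- The straight line from a measure to its discretization. -/
noncomputable def discretizeLine (s : Finset X) (ζ : X → (X →ᵇ ℝ≥0)) (t : I)
    (α : FiniteMeasure X) : FiniteMeasure X :=
  unitInterval.toNNReal (unitInterval.symm t) • α + unitInterval.toNNReal t • discretize s ζ α

lemma coe_discretize (s : Finset X) (ζ : X → (X →ᵇ ℝ≥0)) (α : FiniteMeasure X) :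
    (discretize s ζ α : Measure X) =
      ∑ p ∈ s, α.testAgainstNN (ζ p) • Measure.dirac p := by
  simp only [discretize, FiniteMeasure.toMeasure_sum, FiniteMeasure.toMeasure_smul]
  rfl

lemma coe_discretizeLine (s : Finset X) (ζ : X → (X →ᵇ ℝ≥0)) (t : I) (α : FiniteMeasure X) :
    (discretizeLine s ζ t α : Measure X) =
      unitInterval.toNNReal (unitInterval.symm t) • (α : Measure X) +
        unitInterval.toNNReal t • (discretize s ζ α : Measure X) := by
  simp only [discretizeLine, FiniteMeasure.toMeasure_add, FiniteMeasure.toMeasure_smul]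

/-- The coupling of a measure with a point on the line to its discretization: mass that stays lies
on the diagonal, and the mass with density `ζ p` is moved to `p`. -/
noncomputable def discretizeCoupling (s : Finset X) (ζ : X → (X →ᵇ ℝ≥0)) (t : I)
    (α : FiniteMeasure X) : Measure (X × X) :=
  unitInterval.toNNReal (unitInterval.symm t) • (α : Measure X).map (fun x => (x, x)) +
    unitInterval.toNNReal t •
      ∑ p ∈ s, ((α : Measure X).withDensity (fun x => (ζ p x : ℝ≥0∞))).map (fun x => (x, p))

lemma map_snd_discretizeCoupling (s : Finset X) (ζ : X → (X →ᵇ ℝ≥0)) (t : I)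
    (α : FiniteMeasure X) :
    (discretizeCoupling s ζ t α).map Prod.snd = (discretizeLine s ζ t α : Measure X) := by
  rw [coe_discretizeLine, coe_discretize]
  unfold discretizeCoupling
  rw [Measure.map_add _ _ measurable_snd, Measure.map_smul, Measure.map_smul,
    map_finsetSum_measure measurable_snd,
    Measure.map_map measurable_snd (by fun_prop)]
  have : ∀ p ∈ s, (((α : Measure X).withDensity (fun x => (ζ p x : ℝ≥0∞))).map
      (fun x => (x, p))).map Prod.snd = α.testAgainstNN (ζ p) • Measure.dirac p := by
    intro p _
    rw [Measure.map_map measurable_snd (by fun_prop)]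
    change Measure.map (fun _ => p) _ = _
    rw [Measure.map_const, withDensity_apply _ MeasurableSet.univ, Measure.restrict_univ,
      ← FiniteMeasure.testAgainstNN_coe_eq]
    rfl
  rw [Finset.sum_congr rfl this]
  change _ • Measure.map id _ + _ = _
  rw [Measure.map_id]

variable [BorelSpace X]

instance innerRegular_dirac (p : X) : (Measure.dirac p).InnerRegular where
  innerRegular := by
    intro U hU r hr
    by_cases hp : p ∈ U
    · refine ⟨{p}, Set.singleton_subset_iff.2 hp, isCompact_singleton, ?_⟩
      simpa [Measure.dirac_apply' _ hU, hp] using hr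
    · simp [Measure.dirac_apply' _ hU, hp] at hr

/-- Integrating a fixed bounded continuous function is weakly continuous; this is why the weights
come from a partition of unity and not from a partition into Borel sets. -/
lemma continuous_discretizeLine (s : Finset X) (ζ : X → (X →ᵇ ℝ≥0)) :
    Continuous fun q : I × FiniteMeasure X => discretizeLine s ζ q.1 q.2 := by
  have h1 : Continuous fun α : FiniteMeasure X => discretize s ζ α :=
    continuous_finsetSum _ fun p _ =>
      (FiniteMeasure.continuous_testAgainstNN_eval (ζ p)).smul continuous_const
  unfold discretizeLine
  fun_prop

lemma finite_support_discretize (s : Finset X) (ζ : X → (X →ᵇ ℝ≥0)) (α : FiniteMeasure X) :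
    (discretize s ζ α : Measure X).support.Finite := by
  refine s.finite_toSet.subset (Measure.support_subset_of_isClosed s.finite_toSet.isClosed ?_)
  rw [coe_discretize, mem_ae_iff, Measure.finsetSum_apply]
  refine Finset.sum_eq_zero fun p hp => ?_
  rw [Measure.smul_apply, Measure.dirac_apply' _ s.finite_toSet.isClosed.measurableSet.compl]
  simp [hp]

lemma finite_support_discretizeLine (s : Finset X) (ζ : X → (X →ᵇ ℝ≥0)) (t : I)
    {α : FiniteMeasure X} (hα : (α : Measure X).support.Finite) :
    (discretizeLine s ζ t α : Measure X).support.Finite := by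
  rw [coe_discretizeLine, Measure.support_add]
  exact (hα.subset (Measure.AbsolutelyContinuous.support_mono
      Measure.smul_absolutelyContinuous)).union
    ((finite_support_discretize s ζ α).subset (Measure.AbsolutelyContinuous.support_mono
      Measure.smul_absolutelyContinuous))

lemma sum_withDensity_eq {s : Finset X} {ζ : X → (X →ᵇ ℝ≥0)}
    (hζ : ∀ x, ∑ p ∈ s, ζ p x = 1) (α : Measure X) :
    ∑ p ∈ s, α.withDensity (fun x => (ζ p x : ℝ≥0∞)) = α := by
  ext U hU
  have hm : ∀ p ∈ s, Measurable fun x => (ζ p x : ℝ≥0∞) := fun p _ =>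
    (ζ p).continuous.measurable.coe_nnreal_ennreal
  rw [Measure.finsetSum_apply, Finset.sum_congr rfl fun p _ => withDensity_apply _ hU,
    ← lintegral_finsetSum _ hm]
  simp [← ENNReal.ofNNReal_finsetSum, hζ]

/-- The pieces of `α` with densities `ζ p` add up to `α`, and the weights `1 - t` and `t` add up to
one. -/
lemma map_fst_discretizeCoupling {s : Finset X} {ζ : X → (X →ᵇ ℝ≥0)}
    (hζ : ∀ x, ∑ p ∈ s, ζ p x = 1) (t : I) (α : FiniteMeasure X) :
    (discretizeCoupling s ζ t α).map Prod.fst = (α : Measure X) := by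
  unfold discretizeCoupling
  rw [Measure.map_add _ _ measurable_fst, Measure.map_smul, Measure.map_smul,
    map_finsetSum_measure measurable_fst,
    Measure.map_map measurable_fst (by fun_prop)]
  have : ∀ p ∈ s, (((α : Measure X).withDensity (fun x => (ζ p x : ℝ≥0∞))).map
      (fun x => (x, p))).map Prod.fst = (α : Measure X).withDensity (fun x => (ζ p x : ℝ≥0∞)) := by
    intro p _
    rw [Measure.map_map measurable_fst (by fun_prop)]
    exact Measure.map_id
  rw [Finset.sum_congr rfl this, sum_withDensity_eq hζ]
  change _ • Measure.map id _ + _ = _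
  rw [Measure.map_id, ← add_smul, unitInterval.toNNReal_symm_add_toNNReal, one_smul]

/-- The right-hand set is closed, so its complement only has to be null: the diagonal misses it, and
`ζ p` vanishes at distance more than `ε` from `p`. Second countability makes closed subsets of `X ×
X` measurable for the product `σ`-algebra. -/
lemma support_discretizeCoupling_subset [SecondCountableTopology X] {s : Finset X}
    {ζ : X → (X →ᵇ ℝ≥0)} {ε : ℝ} (hε : 0 ≤ ε) (hd : ∀ p x, ζ p x ≠ 0 → dist x p ≤ ε) (t : I)
    (α : FiniteMeasure X) :
    (discretizeCoupling s ζ t α).support ⊆ {z | dist z.1 z.2 ≤ ε} := by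
  have hc : IsClosed {z : X × X | dist z.1 z.2 ≤ ε} := isClosed_le (by fun_prop) (by fun_prop)
  have hm := hc.measurableSet.compl
  refine Measure.support_subset_of_isClosed hc ?_
  rw [mem_ae_iff, discretizeCoupling, Measure.add_apply, Measure.smul_apply, Measure.smul_apply,
    Measure.finsetSum_apply, Measure.map_apply (by fun_prop) hm, Finset.sum_eq_zero]
  · simp [hε]
  · intro p _
    rw [Measure.map_apply (by fun_prop) hm,
      withDensity_apply _ ((by fun_prop : Measurable fun x : X => (x, p)) hm)]
    refine setLIntegral_eq_zero ((by fun_prop : Measurable fun x : X => (x, p)) hm) ?_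
    intro x hx
    by_contra h
    exact hx (hd p x fun h0 => h (by simp [h0]))

end Discretize

/-! ### Discretization of Radon probability measures -/

section Radon

open scoped BoundedContinuousFunction unitInterval

variable {X : Type u} [MetricSpace X] [MeasurableSpace X] [BorelSpace X]

/-- The straight line from a Radon probability measure to its discretization along a partition of
unity. -/
noncomputable def RadonProb.discretizeLine {s : Finset X} {ζ : X → (X →ᵇ ℝ≥0)}
    (hζ : ∀ x, ∑ p ∈ s, ζ p x = 1) (t : I) (α : RadonProb X) : RadonProb X :=
  ⟨⟨_root_.discretizeLine s ζ t α.1.toFiniteMeasure, ⟨by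
      -- Both marginals have the total mass of the coupling, and the first marginal is `α`.
      rw [← map_snd_discretizeCoupling, Measure.map_apply measurable_snd MeasurableSet.univ]
      have h := congrArg (· Set.univ) (map_fst_discretizeCoupling hζ t α.1.toFiniteMeasure)
      simpa [Measure.map_apply measurable_fst MeasurableSet.univ] using h⟩⟩, by
    have := α.2
    rw [ProbabilityMeasure.coe_mk, coe_discretizeLine, coe_discretize,
      ProbabilityMeasure.toMeasure_comp_toFiniteMeasure_eq_toMeasure]
    infer_instance⟩

variable {s : Finset X} {ζ : X → (X →ᵇ ℝ≥0)} (hζ : ∀ x, ∑ p ∈ s, ζ p x = 1)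

lemma RadonProb.continuous_discretizeLine :
    Continuous fun q : I × RadonProb X => RadonProb.discretizeLine hζ q.1 q.2 := by
  refine Continuous.subtype_mk
    ((ProbabilityMeasure.toFiniteMeasure_isEmbedding X).continuous_iff.2 ?_) _
  exact (_root_.continuous_discretizeLine s ζ).comp (f := fun q : I × RadonProb X =>
    (q.1, q.2.1.toFiniteMeasure)) (continuous_fst.prodMk
      (ProbabilityMeasure.toFiniteMeasure_continuous.comp
        (continuous_subtype_val.comp continuous_snd)))

lemma RadonProb.discretizeLine_zero (α : RadonProb X) : RadonProb.discretizeLine hζ 0 α = α := by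
  refine Subtype.ext (Subtype.ext ?_)
  change (_root_.discretizeLine s ζ 0 α.1.toFiniteMeasure : Measure X) = _
  rw [coe_discretizeLine]
  simp

lemma RadonProb.finite_support_discretizeLine_one (α : RadonProb X) :
    ((RadonProb.discretizeLine hζ 1 α).1 : Measure X).support.Finite := by
  change (_root_.discretizeLine s ζ 1 α.1.toFiniteMeasure : Measure X).support.Finite
  rw [coe_discretizeLine]
  simpa using finite_support_discretize s ζ α.1.toFiniteMeasure

lemma RadonProb.wassersteinInfty_discretizeLine_le [SecondCountableTopology X] {ε : ℝ}
    (hε : 0 ≤ ε) (hd : ∀ p x, ζ p x ≠ 0 → dist x p ≤ ε) (t : I) (α : RadonProb X) :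
    wassersteinInfty α (RadonProb.discretizeLine hζ t α) ≤ ENNReal.ofReal ε := by
  refine (iInf₂_le (_root_.discretizeCoupling s ζ t α.1.toFiniteMeasure)
    ⟨map_fst_discretizeCoupling hζ t _, map_snd_discretizeCoupling s ζ t _⟩).trans ?_
  refine iSup₂_le fun z hz => ?_
  rw [edist_dist]
  exact ENNReal.ofReal_le_ofReal (support_discretizeCoupling_subset hε hd t _ hz)

end Radon

/-! ### Controlled invariants along the discretization -/

theorem IsControlledInvariant.abs_sub_le_of_wassersteinInfty_le {L : ℝ} {i : MeasureFunctional.{u}}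
    (hi : IsControlledInvariant L i) {X : Type u} [MetricSpace X] [BoundedSpace X]
    [MeasurableSpace X] [BorelSpace X] {α β : RadonProb X} {ε : ℝ} (hε : 0 ≤ ε)
    (h : wassersteinInfty α β ≤ ENNReal.ofReal ε) : |i X α - i X β| ≤ 2 * L * ε := by
  have hL : 0 ≤ 2 * L := by linarith [hi.pos]
  rw [← ENNReal.ofReal_le_ofReal_iff (mul_nonneg hL hε), ENNReal.ofReal_mul hL]
  exact (hi.abs_sub_le X α β).trans (by gcongr)

theorem IsControlledInvariant.deltaHomotopyEquiv {L : ℝ} {i : MeasureFunctional.{u}}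
    (hi : IsControlledInvariant L i) {X : Type u} [MetricSpace X] [BoundedSpace X]
    [MeasurableSpace X] [BorelSpace X] (hX : TotallyBounded (Set.univ : Set X)) {ε : ℝ}
    (hε : 0 < ε) :
    DeltaHomotopyEquiv (i X) (fun α : FinRadonProb X => i X α.1) (2 * L * ε) := by
  have : SecondCountableTopology X := by
    have : TopologicalSpace.SeparableSpace X :=
      TopologicalSpace.isSeparable_univ_iff.1 hX.isSeparable
    exact UniformSpace.secondCountable_of_separable X
  obtain ⟨s, ζ, hζ, hd⟩ := exists_finite_partitionOfUnity hX hε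
  have hpos : 0 ≤ 2 * L * ε := by have := hi.pos; positivity
  have hle : ∀ t α, i X (RadonProb.discretizeLine hζ t α) ≤ i X α + 2 * L * ε := fun t α => by
    linarith [(abs_le.1 (hi.abs_sub_le_of_wassersteinInfty_le hε.le
      (RadonProb.wassersteinInfty_discretizeLine_le hζ hε.le hd t α))).1]
  have hcont := RadonProb.continuous_discretizeLine hζ
  let Φ : C(RadonProb X, FinRadonProb X) :=
    ⟨fun α => ⟨RadonProb.discretizeLine hζ 1 α, RadonProb.finite_support_discretizeLine_one hζ α⟩,
      (hcont.comp (Continuous.prodMk_right 1)).subtype_mk _⟩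
  let Ψ : C(FinRadonProb X, RadonProb X) := ⟨Subtype.val, continuous_subtype_val⟩
  refine ⟨Φ, Ψ, fun α => hle 1 α, fun α => le_add_of_nonneg_right hpos, ?_, ?_⟩
  -- The segment starts at the identity and ends at the discretization, hence the reversal.
  · refine ContinuousMap.HomotopicWith.symm ⟨⟨⟨⟨_, hcont⟩,
      RadonProb.discretizeLine_zero hζ, fun α => rfl⟩, fun t α => ?_⟩⟩
    exact (hle t α).trans (by linarith)
  -- The same segment stays among the finitely supported measures when it starts there.
  · refine ContinuousMap.HomotopicWith.symm ⟨⟨⟨⟨fun q => ⟨RadonProb.discretizeLine hζ q.1 q.2.1,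
      finite_support_discretizeLine s ζ q.1 q.2.2⟩, ?_⟩, fun α => Subtype.ext
        (RadonProb.discretizeLine_zero hζ α.1), fun α => rfl⟩, fun t α => ?_⟩⟩
    · exact (hcont.comp (continuous_fst.prodMk
        (continuous_subtype_val.comp continuous_snd))).subtype_mk _
    · exact (hle t α.1).trans (by linarith)

theorem IsControlledInvariant.homotopyTypeDist_eq_zero {L : ℝ} {i : MeasureFunctional.{u}}
    (hi : IsControlledInvariant L i) {X : Type u} [MetricSpace X] [BoundedSpace X]
    [MeasurableSpace X] [BorelSpace X] (hX : TotallyBounded (Set.univ : Set X)) :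
    homotopyTypeDist (i X) (fun α : FinRadonProb X => i X α.1) = 0 := by
  have hL := hi.pos
  refine le_antisymm (ENNReal.le_of_forall_pos_le_add fun δ hδ _ => ?_) zero_le
  rw [zero_add]
  -- This `ε` turns the shift `2 * L * ε` into `δ`.
  have h := hi.deltaHomotopyEquiv hX (ε := δ / (2 * L)) (by positivity)
  rw [mul_div_cancel₀ _ (by positivity)] at h
  exact iInf₂_le δ h

theorem corollary5p5 (K : Type v) [Field K] (k : ℕ)
    (L : ℝ) (i : MeasureFunctional.{u}) (hi : IsControlledInvariant L i)
    (X : Type u) [MetricSpace X] [MeasurableSpace X] [BorelSpace X]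
    (hX : TotallyBounded (Set.univ : Set X)) :
    haveI : BoundedSpace X := ⟨hX.isBounded⟩
    interleavingDist (persistentHomology K k (i X))
        (persistentHomology K k fun α : FinRadonProb X => i X α.1) =
      homotopyTypeDist (i X) (fun α : FinRadonProb X => i X α.1) ∧
    homotopyTypeDist (i X) (fun α : FinRadonProb X => i X α.1) = 0 := by
  have : BoundedSpace X := ⟨hX.isBounded⟩
  have h := hi.homotopyTypeDist_eq_zero hX
  refine ⟨le_antisymm (interleavingDist_persistentHomology_le K k _ _) ?_, h⟩
  rw [h]
  exact zero_le
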